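/- Let $K\subseteq\mathbb{R}^p$ be an ordering cone (a closed, convex, pointed cone, $K\neq\{0\}$) with nonempty interior, and let $K^*=\{y: y^Tx\le 0\ \forall x\in K\}$ be its polar cone. Let $f=(f_1,\dots,f_p):\mathbb{R}^n\to\mathbb{R}^p$ have locally Lipschitz components, let $J$ be an index set (possibly infinite, with a topology), and let $g_j:\mathbb{R}^n\to\mathbb{R}$, $j\in J$, be convex. Consider the semi-infinite vector optimization problem of minimizing $f(x)$ with respect to $K$ over $\Omega_1=\{x: g_j(x)\le 0\ \forall j\in J\}$, let $\bar x\in\Omega_1$, and put $A(\bar x)=\{j\in J: g_j(\bar x)=0\}$. Notation. The point $\bar x$ is norm-based robust efficient if there is $r>0$ such that for every real $p\times n$ matrix $C$ with Frobenius norm less than $r$ there is no $x\in\Omega_1$ with $(f(x)+Cx)-(f(\bar x)+C\bar x)\in -K\setminus\{0\}$. The set $\mathrm{co}\,S$ is the convex hull of $S$, and $\mathrm{pos}\,S$ is the set of all finite nonnegative linear combinations of elements of $S$ (so $\mathrm{pos}\,\emptyset=\{0\}$). The set $\partial g_j$ is the convex subdifferential. For a locally Lipschitz $h:\mathbb{R}^n\to\mathbb{R}$,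 $\partial_c h(\bar x)=\{\zeta: \zeta^Td\le h^\circ(\bar x;d)\ \forall d\in\mathbb{R}^n\}$ is Clarke's generalized gradient, where $h^\circ(\bar x;d)=\limsup_{x\to\bar x,\,t\downarrow0}\frac{h(x+td)-h(x)}{t}$. The set $\partial_c f(\bar x)$ consists of all $n\times p$ matrices whose $i$-th column lies in $\partial_c f_i(\bar x)$ for $i=1,\dots,p$, and $-\partial_c f(\bar x)K^*=\{-\xi y:\xi\in\partial_c f(\bar x),\ y\in K^*\}$. For $\mu^*\in\mathbb{R}^p$, $(\mu^*\circ f)(x)=\mu^{*T}f(x)$. The function $f$ is $K$-convex if $f(\lambda x+(1-\lambda)y)-\lambda f(x)-(1-\lambda)f(y)\in -K$ for all $x,y\in\mathbb{R}^n$ and $\lambda\in[0,1]$. The Slater constraint qualification (SCQ) holds if $J$ is compact, $(j,x)\mapsto g_j(x)$ is continuous on $J\times\mathbb{R}^n$, and there is $x^\circ\in\mathbb{R}^n$ with $g_j(x^\circ)<0$ for all $j\in J$. Then: (i) If $0\notin \mathrm{co}\big(\bigcup_{j\in A(\bar x)}\partial g_j(\bar x)\big)$, SCQ holds, and $\bar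 x$ is a norm-based robust efficient solution, then $$\mathrm{co}\big(-\partial_c f(\bar x)K^*\big)+\mathrm{pos}\Big(\bigcup_{j\in A(\bar x)}\partial g_j(\bar x)\Big)=\mathbb{R}^n.$$ (ii) If $f$ is $K$-convex and $$\mathrm{pos}\Big(\bigcup_{\mu^*\in -K^*}\partial_c(\mu^*\circ f)(\bar x)\Big)+\mathrm{pos}\Big(\bigcup_{j\in A(\bar x)}\partial g_j(\bar x)\Big)=\mathbb{R}^n,$$ then $\bar x$ is a norm-based robust efficient solution. -/

import Mathlib

open scoped Pointwise

noncomputable section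

namespace RobustVOP

/-- Euclidean space `ℝⁿ`. -/
abbrev E (n : ℕ) := EuclideanSpace ℝ (Fin n)

/-- The matrix-vector product `C x`, as a map between Euclidean spaces. -/
def matVec {m n : ℕ} (C : Matrix (Fin m) (Fin n) ℝ) (x : E n) : E m :=
  WithLp.toLp 2 (C.mulVec x.ofLp)

/-- `W V = {w v : w ∈ W, v ∈ V}` for a set `W` of matrices and a set `V` of vectors. -/
def matSetMul {m n : ℕ} (W : Set (Matrix (Fin m) (Fin n) ℝ)) (V : Set (E n)) : Set (E m) :=
  Set.image2 matVec W V

section Frobenius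

attribute [local instance] Matrix.frobeniusNormedAddCommGroup

/-- `M(m, n; r)`: the real `m × n` matrices with Frobenius norm less than `r`. -/
def frobeniusBall (m n : ℕ) (r : ℝ) : Set (Matrix (Fin m) (Fin n) ℝ) :=
  {C | ‖C‖ < r}

end Frobenius

/-- An ordering cone: a nontrivial closed pointed convex cone. -/
structure IsOrderingCone {p : ℕ} (K : Set (E p)) : Prop where
  smul_mem : ∀ x ∈ K, ∀ c : ℝ, 0 ≤ c → c • x ∈ K
  nontrivial : K ≠ {0}
  closed : IsClosed K
  pointed : K ∩ -K = {0}
  convex : Convex ℝ K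

/-- The polar cone `K* = {y : yᵀx ≤ 0 for all x ∈ K}`. -/
def polarCone {p : ℕ} (K : Set (E p)) : Set (E p) :=
  {y | ∀ x ∈ K, inner ℝ y x ≤ 0}

/-- `pos S`: the set of all finite nonnegative combinations of elements of `S`. The empty
combination is allowed, so that `pos ∅ = {0}`. -/
def pos {n : ℕ} (S : Set (E n)) : Set (E n) :=
  {z | ∃ (m : ℕ) (c : Fin m → ℝ) (y : Fin m → E n),
    (∀ i, 0 ≤ c i) ∧ (∀ i, y i ∈ S) ∧ z = ∑ i, c i • y i}

/-- `f` is `K`-convex. -/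
def KConvex {n p : ℕ} (K : Set (E p)) (f : E n → E p) : Prop :=
  ∀ x y : E n, ∀ l : ℝ, 0 ≤ l → l ≤ 1 →
    f (l • x + (1 - l) • y) - l • f x - (1 - l) • f y ∈ -K

/-- The subdifferential of convex analysis. -/
def subdifferential {n : ℕ} (h : E n → ℝ) (x₀ : E n) : Set (E n) :=
  {ζ | ∀ x, h x - h x₀ ≥ inner ℝ ζ (x - x₀)}

/-- Clarke's generalized directional derivative: the upper limit of `(h (x + t d) - h x) / t` as
`x → x₀` and `t ↓ 0`. It is used for locally Lipschitz `h` only, where the quotients are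
bounded near the limit, so that the real upper limit is the true one. -/
def clarkeDeriv {n : ℕ} (h : E n → ℝ) (x₀ d : E n) : ℝ :=
  Filter.limsup (fun q : E n × ℝ => (h (q.1 + q.2 • d) - h q.1) / q.2)
    (nhds x₀ ×ˢ nhdsWithin 0 (Set.Ioi 0))

/-- Clarke's generalized gradient of a real-valued locally Lipschitz function. -/
def clarkeGradient {n : ℕ} (h : E n → ℝ) (x₀ : E n) : Set (E n) :=
  {ζ | ∀ d, clarkeDeriv h x₀ d ≥ inner ℝ ζ d}

/-- The generalized gradient of a vector-valued function `f = (f₁, …, f_p)`: all `n × p` matrices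
whose `i`-th column belongs to the generalized gradient of `f_i`, for every `i`. -/
def clarkeGradientVec {n p : ℕ} (f : E n → E p) (x₀ : E n) : Set (Matrix (Fin n) (Fin p) ℝ) :=
  {ξ | ∀ i, (WithLp.toLp 2 (fun k => ξ k i) : E n) ∈ clarkeGradient (fun x => f x i) x₀}

/-- `x₀` is an efficient solution of `min f(x)` s.t. `x ∈ Ω`, with respect to `K`. -/
def IsEfficient {n p : ℕ} (K : Set (E p)) (f : E n → E p) (Ω : Set (E n)) (x₀ : E n) : Prop :=
  x₀ ∈ Ω ∧ ¬ ∃ x ∈ Ω, f x - f x₀ ∈ (-K) \ {0}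

/-- `x₀` is a norm-based robust efficient solution of `min f(x)` s.t. `x ∈ Ω`, with respect
to `K`. -/
def IsNormRobust {n p : ℕ} (K : Set (E p)) (f : E n → E p) (Ω : Set (E n)) (x₀ : E n) : Prop :=
  ∃ r : ℝ, 0 < r ∧ ∀ C ∈ frobeniusBall p n r, IsEfficient K (fun x => f x + matVec C x) Ω x₀

/-- The feasible set `{x : g_j(x) ≤ 0 for all j}`. -/
def feasibleSet {n : ℕ} {J : Type*} (g : J → E n → ℝ) : Set (E n) :=
  {x | ∀ j, g j x ≤ 0}

/-- The indices of the constraints that are active at `x₀`. -/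
def activeSet {n : ℕ} {J : Type*} (g : J → E n → ℝ) (x₀ : E n) : Set J :=
  {j | g j x₀ = 0}

/-- The Slater constraint qualification. -/
structure SCQ {n : ℕ} {J : Type*} [TopologicalSpace J] (g : J → E n → ℝ) : Prop where
  compact : CompactSpace J
  continuous : Continuous (fun q : J × E n => g q.1 q.2)
  slater : ∃ x : E n, ∀ j, g j x < 0

end RobustVOP

end

open RobustVOP

namespace RobustVOP

/-! (i) The sum of the two sets is a convex cone containing 0. If it is not the whole space, it has
a nonzero polar vector `d`, which is nonpositive on both summands. The columns of a matrix in `∂_c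
f(x₀)` are chosen independently, and by Hahn–Banach each column takes every value in `[-f_i°(x₀;
-d), f_i°(x₀; d)]` on `d`. The bipolar theorem then puts the whole box of such value vectors in `-K`
(`neg_mem_of_forall_clarkeDeriv`). Tilting `d` slightly towards a Slater point makes it feasible
(`eventually_mem_feasibleSet`), and the difference quotients of `f` stay close to the box. An
arbitrarily small rank-one `C` sending `d` to `-ε e`, with `e` interior to `K`, absorbs the
remaining error, so `x₀` is dominated after perturbation (`not_isNormRobust_of_direction`).

(ii) If `x` dominates `x₀` after a perturbation of size less than `r`, every generator `z` of the
two cones satisfies `⟨z, x - x₀⟩ ≤ M r ‖x - x₀‖`, with `M` depending on `z` only. Such `z` form a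
convex cone, hence here all of `ℝⁿ`. Testing `±` the basis vectors gives `‖x - x₀‖ ≤ N r ‖x - x₀‖`,
which forces `x = x₀` for small `r`. -/

/-! ### Clarke's directional derivative and gradient -/

/-- The difference quotient whose upper limit is Clarke's derivative. -/
noncomputable def clarkeQuotient {n : ℕ} (h : E n → ℝ) (d : E n) (q : E n × ℝ) : ℝ :=
  (h (q.1 + q.2 • d) - h q.1) / q.2

/-- The filter `x → x₀`, `t ↓ 0`. -/
def clarkeFilter {n : ℕ} (x₀ : E n) : Filter (E n × ℝ) :=
  nhds x₀ ×ˢ nhdsWithin 0 (Set.Ioi 0)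

instance clarkeFilter_neBot {n : ℕ} (x₀ : E n) : (clarkeFilter x₀).NeBot := by
  unfold clarkeFilter; infer_instance

theorem eventually_pos_clarkeFilter {n : ℕ} (x₀ : E n) :
    ∀ᶠ q in clarkeFilter x₀, 0 < q.2 := by
  have : ∀ᶠ t : ℝ in nhdsWithin 0 (Set.Ioi 0), 0 < t := self_mem_nhdsWithin
  exact Filter.tendsto_snd.eventually this

theorem tendsto_fst_clarkeFilter {n : ℕ} (x₀ : E n) :
    Filter.Tendsto Prod.fst (clarkeFilter x₀) (nhds x₀) := Filter.tendsto_fst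

theorem tendsto_snd_clarkeFilter {n : ℕ} (x₀ : E n) :
    Filter.Tendsto Prod.snd (clarkeFilter x₀) (nhds 0) :=
  Filter.tendsto_snd.mono_right nhdsWithin_le_nhds

theorem tendsto_clarkeFilter {n : ℕ} {α : Type*} {l : Filter α} {x₀ : E n} {u : α → E n}
    {t : α → ℝ} (hu : Filter.Tendsto u l (nhds x₀)) (ht : Filter.Tendsto t l (nhds 0))
    (hpos : ∀ᶠ a in l, 0 < t a) :
    Filter.Tendsto (fun a => (u a, t a)) l (clarkeFilter x₀) :=
  hu.prodMk (tendsto_nhdsWithin_iff.2 ⟨ht, hpos⟩)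

theorem tendsto_shift_clarkeFilter {n : ℕ} (x₀ d : E n) :
    Filter.Tendsto (fun q : E n × ℝ => q.1 + q.2 • d) (clarkeFilter x₀) (nhds x₀) := by
  simpa using (tendsto_fst_clarkeFilter x₀).add ((tendsto_snd_clarkeFilter x₀).smul_const d)

/-- The local Lipschitz constant bounds the quotients. Without this bound the real `limsup` could be
a junk value. -/
theorem exists_eventually_abs_clarkeQuotient_le {n : ℕ} {h : E n → ℝ} (hh : LocallyLipschitz h)
    (x₀ d : E n) : ∃ M : ℝ, ∀ᶠ q in clarkeFilter x₀, |clarkeQuotient h d q| ≤ M := by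
  obtain ⟨L, s, hs, hL⟩ := hh x₀
  refine ⟨L * ‖d‖, ?_⟩
  filter_upwards [eventually_pos_clarkeFilter x₀, (tendsto_fst_clarkeFilter x₀).eventually hs,
    (tendsto_shift_clarkeFilter x₀ d).eventually hs] with q hq h1 h2
  have h3 := hL.dist_le_mul _ h2 _ h1
  rw [Real.dist_eq, dist_eq_norm, add_sub_cancel_left, norm_smul, Real.norm_eq_abs,
    abs_of_pos hq] at h3
  rw [clarkeQuotient, abs_div, abs_of_pos hq, div_le_iff₀ hq]
  linarith

theorem clarkeDeriv_le {n : ℕ} {h : E n → ℝ} (hh : LocallyLipschitz h) {x₀ d : E n} {c : ℝ}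
    (hc : ∀ᶠ q in clarkeFilter x₀, clarkeQuotient h d q ≤ c) : clarkeDeriv h x₀ d ≤ c := by
  obtain ⟨M, hM⟩ := exists_eventually_abs_clarkeQuotient_le hh x₀ d
  have hb : (clarkeFilter x₀).IsBoundedUnder (· ≥ ·) (clarkeQuotient h d) :=
    ⟨-M, Filter.eventually_map.2 (hM.mono fun q hq => (abs_le.1 hq).1)⟩
  exact Filter.limsup_le_of_le hb.isCoboundedUnder_le hc

theorem eventually_clarkeQuotient_lt {n : ℕ} {h : E n → ℝ} (hh : LocallyLipschitz h) {x₀ d : E n}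
    {c : ℝ} (hc : clarkeDeriv h x₀ d < c) :
    ∀ᶠ q in clarkeFilter x₀, clarkeQuotient h d q < c := by
  obtain ⟨M, hM⟩ := exists_eventually_abs_clarkeQuotient_le hh x₀ d
  have hb : (clarkeFilter x₀).IsBoundedUnder (· ≤ ·) (clarkeQuotient h d) :=
    ⟨M, Filter.eventually_map.2 (hM.mono fun q hq => (abs_le.1 hq).2)⟩
  exact Filter.eventually_lt_of_limsup_lt hc hb

theorem clarkeDeriv_add_le {n : ℕ} {h : E n → ℝ} (hh : LocallyLipschitz h) (x₀ d e : E n) :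
    clarkeDeriv h x₀ (d + e) ≤ clarkeDeriv h x₀ d + clarkeDeriv h x₀ e := by
  refine le_of_forall_pos_le_add fun ε hε => clarkeDeriv_le hh ?_
  have h1 := eventually_clarkeQuotient_lt hh
    (show clarkeDeriv h x₀ d < clarkeDeriv h x₀ d + ε / 2 by linarith)
  have h2 := eventually_clarkeQuotient_lt hh
    (show clarkeDeriv h x₀ e < clarkeDeriv h x₀ e + ε / 2 by linarith)
  -- Moving the base point to `x + t e` does not change the limit, so the quotient along `d + e`
  -- telescopes.
  have h3 := (tendsto_clarkeFilter (tendsto_shift_clarkeFilter x₀ e)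
    (tendsto_snd_clarkeFilter x₀) (eventually_pos_clarkeFilter x₀)).eventually h1
  filter_upwards [h2, h3] with q hq2 hq3
  have : clarkeQuotient h (d + e) q =
      clarkeQuotient h d (q.1 + q.2 • e, q.2) + clarkeQuotient h e q := by
    simp only [clarkeQuotient]
    rw [show q.1 + q.2 • (d + e) = q.1 + q.2 • e + q.2 • d by module, ← add_div]
    ring
  linarith

theorem clarkeDeriv_smul_le {n : ℕ} {h : E n → ℝ} (hh : LocallyLipschitz h) (x₀ d : E n) {c : ℝ}
    (hc : 0 < c) : clarkeDeriv h x₀ (c • d) ≤ c * clarkeDeriv h x₀ d := by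
  refine le_of_forall_pos_le_add fun ε hε => clarkeDeriv_le hh ?_
  have h1 := eventually_clarkeQuotient_lt hh
    (show clarkeDeriv h x₀ d < clarkeDeriv h x₀ d + ε / c by
      have := div_pos hε hc; linarith)
  have h2 : Filter.Tendsto (fun q : E n × ℝ => (q.1, c * q.2)) (clarkeFilter x₀)
      (clarkeFilter x₀) :=
    tendsto_clarkeFilter (tendsto_fst_clarkeFilter x₀)
      (by simpa using (tendsto_snd_clarkeFilter x₀).const_mul c)
      ((eventually_pos_clarkeFilter x₀).mono fun q hq => mul_pos hc hq)
  filter_upwards [h2.eventually h1, eventually_pos_clarkeFilter x₀] with q hq hpos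
  have : clarkeQuotient h (c • d) q = c * clarkeQuotient h d (q.1, c * q.2) := by
    simp only [clarkeQuotient]
    rw [smul_smul, mul_comm q.2 c]
    field_simp
  rw [this]
  have h4 := mul_lt_mul_of_pos_left hq hc
  rw [mul_add, mul_div_cancel₀ _ hc.ne'] at h4
  exact h4.le

theorem clarkeDeriv_smul {n : ℕ} {h : E n → ℝ} (hh : LocallyLipschitz h) (x₀ d : E n) {c : ℝ}
    (hc : 0 < c) : clarkeDeriv h x₀ (c • d) = c * clarkeDeriv h x₀ d := by
  refine le_antisymm (clarkeDeriv_smul_le hh x₀ d hc) ?_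
  have := clarkeDeriv_smul_le hh x₀ (c • d) (inv_pos.2 hc)
  rw [smul_smul, inv_mul_cancel₀ hc.ne', one_smul] at this
  calc c * clarkeDeriv h x₀ d ≤ c * (c⁻¹ * clarkeDeriv h x₀ (c • d)) := by gcongr
    _ = _ := by field_simp

theorem clarkeDeriv_zero {n : ℕ} {h : E n → ℝ} (hh : LocallyLipschitz h) (x₀ : E n) :
    clarkeDeriv h x₀ 0 = 0 := by
  have := clarkeDeriv_smul hh x₀ 0 (c := 2) (by norm_num)
  rw [smul_zero] at this
  linarith

theorem neg_clarkeDeriv_neg_le {n : ℕ} {h : E n → ℝ} (hh : LocallyLipschitz h) (x₀ d : E n) :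
    -clarkeDeriv h x₀ (-d) ≤ clarkeDeriv h x₀ d := by
  have := clarkeDeriv_add_le hh x₀ d (-d)
  rw [add_neg_cancel, clarkeDeriv_zero hh] at this
  linarith

/-- Every value between `-h°(x₀; -d)` and `h°(x₀; d)` is attained on the generalized gradient. -/
theorem exists_mem_clarkeGradient_inner_eq {n : ℕ} {h : E n → ℝ} (hh : LocallyLipschitz h)
    {x₀ d : E n} {v : ℝ} (hv₁ : -clarkeDeriv h x₀ (-d) ≤ v) (hv₂ : v ≤ clarkeDeriv h x₀ d) :
    ∃ ζ ∈ clarkeGradient h x₀, inner ℝ ζ d = v := by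
  have H : ∀ c : ℝ, c • d = 0 → c • v = 0 := by
    intro c hc
    rcases smul_eq_zero.1 hc with rfl | rfl
    · simp
    · rw [neg_zero, clarkeDeriv_zero hh] at hv₁
      rw [clarkeDeriv_zero hh] at hv₂
      rw [show v = 0 by linarith, smul_zero]
  -- Hahn–Banach: `c • d ↦ c * v` on the line of `d` is dominated by the sublinear `h°(x₀; ·)`. The
  -- upper bound on `v` serves `c > 0`, the lower one `c < 0`.
  obtain ⟨φ, hφ₁, hφ₂⟩ := exists_extension_of_le_sublinear
    (LinearPMap.mkSpanSingleton' (σ := RingHom.id ℝ) d v H) (clarkeDeriv h x₀)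
    (fun c hc x => clarkeDeriv_smul hh x₀ x hc) (clarkeDeriv_add_le hh x₀) (by
      rintro ⟨x, hx⟩
      obtain ⟨c, rfl⟩ := Submodule.mem_span_singleton.1 hx
      rw [LinearPMap.mkSpanSingleton'_apply]
      simp only [RingHom.id_apply, smul_eq_mul]
      rcases lt_trichotomy c 0 with hc | rfl | hc
      · rw [show c • d = (-c) • (-d) by module, clarkeDeriv_smul hh _ _ (neg_pos.2 hc)]
        nlinarith
      · simp [clarkeDeriv_zero hh]
      · rw [clarkeDeriv_smul hh _ _ hc]
        exact mul_le_mul_of_nonneg_left hv₂ hc.le)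
  refine ⟨(InnerProductSpace.toDual ℝ (E n)).symm (LinearMap.toContinuousLinearMap φ), ?_, ?_⟩
  · intro y
    simpa using hφ₂ y
  · have h1 := (hφ₁ ⟨d, Submodule.mem_span_singleton_self d⟩).trans
      (LinearPMap.mkSpanSingleton'_apply_self d v H _)
    simpa using h1

/-- For `t < 1` convexity bounds the quotient by the unit-step increment, which is continuous in the
base point. -/
theorem clarkeGradient_subset_subdifferential {n : ℕ} {h : E n → ℝ} (hc : ConvexOn ℝ Set.univ h)
    (x₀ : E n) : clarkeGradient h x₀ ⊆ subdifferential h x₀ := by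
  have hh : LocallyLipschitz h := hc.locallyLipschitz
  intro ζ hζ x
  refine le_trans (hζ (x - x₀)) ?_
  refine le_of_forall_pos_le_add fun ε hε => clarkeDeriv_le hh ?_
  have hcont : Filter.Tendsto (fun q : E n × ℝ => h (q.1 + (x - x₀)) - h q.1) (clarkeFilter x₀)
      (nhds (h (x₀ + (x - x₀)) - h x₀)) :=
    ((hh.continuous.continuousAt.tendsto.comp
      ((tendsto_fst_clarkeFilter x₀).add_const (x - x₀)))).sub
      (hh.continuous.continuousAt.tendsto.comp (tendsto_fst_clarkeFilter x₀))
  rw [add_sub_cancel] at hcont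
  filter_upwards [hcont.eventually_lt_const (lt_add_of_pos_right _ hε),
    eventually_pos_clarkeFilter x₀,
    (tendsto_snd_clarkeFilter x₀).eventually_lt_const one_pos] with q hq hpos hlt
  refine le_trans ?_ hq.le
  rw [clarkeQuotient, div_le_iff₀ hpos]
  have := hc.2 (Set.mem_univ q.1) (Set.mem_univ (q.1 + (x - x₀)))
    (sub_nonneg.2 hlt.le) hpos.le (by ring)
  rw [show (1 - q.2) • q.1 + q.2 • (q.1 + (x - x₀)) = q.1 + q.2 • (x - x₀) by module] at this
  simp only [smul_eq_mul] at this
  linarith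

/-! ### Matrices and the Frobenius norm -/

theorem matVec_add {m n : ℕ} (C : Matrix (Fin m) (Fin n) ℝ) (x y : E n) :
    matVec C (x + y) = matVec C x + matVec C y := by
  simp [matVec, Matrix.mulVec_add]

theorem matVec_smul {m n : ℕ} (C : Matrix (Fin m) (Fin n) ℝ) (c : ℝ) (x : E n) :
    matVec C (c • x) = c • matVec C x := by
  simp [matVec, Matrix.mulVec_smul]

theorem matVec_sub {m n : ℕ} (C : Matrix (Fin m) (Fin n) ℝ) (x y : E n) :
    matVec C (x - y) = matVec C x - matVec C y := by
  simp [matVec, Matrix.mulVec_sub]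

theorem inner_matVec_neg {m n : ℕ} (ξ : Matrix (Fin m) (Fin n) ℝ) (y : E n) (d : E m) :
    inner ℝ d (matVec (-ξ) y) =
      -∑ i, y i * inner ℝ (WithLp.toLp 2 (fun k => ξ k i) : E m) d := by
  simp only [matVec, PiLp.inner_apply, Matrix.mulVec, dotProduct, RCLike.inner_apply, conj_trivial,
    Matrix.neg_apply, Finset.sum_mul, Finset.mul_sum]
  rw [Finset.sum_comm, ← Finset.sum_neg_distrib]
  refine Finset.sum_congr rfl fun i _ => ?_
  rw [← Finset.sum_neg_distrib]
  exact Finset.sum_congr rfl fun j _ => by ring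

section Frobenius

attribute [local instance] Matrix.frobeniusNormedAddCommGroup Matrix.frobeniusNormedSpace

theorem norm_matVec_le {m n : ℕ} {C : Matrix (Fin m) (Fin n) ℝ} {r : ℝ}
    (hC : C ∈ frobeniusBall m n r) (x : E n) : ‖matVec C x‖ ≤ r * ‖x‖ := by
  -- Submultiplicativity, with `x` read as a one-column matrix.
  have h := Matrix.frobenius_norm_mul C (Matrix.replicateCol Unit x.ofLp)
  rw [← Matrix.replicateCol_mulVec, Matrix.frobenius_norm_replicateCol,
    Matrix.frobenius_norm_replicateCol] at h
  have h2 : ‖C‖ < r := hC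
  exact h.trans (mul_le_mul_of_nonneg_right h2.le (norm_nonneg _))

theorem exists_smul_mem_frobeniusBall {m n : ℕ} (C : Matrix (Fin m) (Fin n) ℝ) {r : ℝ}
    (hr : 0 < r) : ∃ ε : ℝ, 0 < ε ∧ ε • C ∈ frobeniusBall m n r := by
  refine ⟨r / (‖C‖ + 1), by positivity, ?_⟩
  change ‖_ • C‖ < r
  rw [norm_smul, Real.norm_eq_abs, abs_of_pos (by positivity), div_mul_eq_mul_div,
    div_lt_iff₀ (by positivity)]
  nlinarith [norm_nonneg C]

end Frobenius

/-! ### Generated cones, separation and ordering cones -/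

/-- As a span over `NNReal`, the cone inherits its closure properties, and inclusions need checking
on generators only. -/
theorem pos_eq_span {n : ℕ} (S : Set (E n)) :
    pos S = (Submodule.span NNReal S : Set (E n)) := by
  ext z
  rw [SetLike.mem_coe, Submodule.mem_span_set']
  constructor
  · rintro ⟨m, c, y, hc, hy, rfl⟩
    exact ⟨m, fun i => ⟨c i, hc i⟩, fun i => ⟨y i, hy i⟩, rfl⟩
  · rintro ⟨m, c, y, rfl⟩
    exact ⟨m, fun i => c i, fun i => y i, fun i => (c i).2, fun i => (y i).2, rfl⟩

theorem subset_pos {n : ℕ} (S : Set (E n)) : S ⊆ pos S := by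
  rw [pos_eq_span]; exact Submodule.subset_span

theorem zero_mem_pos {n : ℕ} (S : Set (E n)) : 0 ∈ pos S := by
  rw [pos_eq_span]; exact zero_mem _

theorem smul_mem_pos {n : ℕ} {S : Set (E n)} {z : E n} (hz : z ∈ pos S) {c : ℝ} (hc : 0 ≤ c) :
    c • z ∈ pos S := by
  rw [pos_eq_span] at *
  exact Submodule.smul_mem _ (⟨c, hc⟩ : NNReal) hz

theorem convex_pos {n : ℕ} (S : Set (E n)) : Convex ℝ (pos S) := by
  intro x hx y hy a b ha hb _
  have h1 := smul_mem_pos hx ha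
  have h2 := smul_mem_pos hy hb
  rw [pos_eq_span] at *
  exact add_mem h1 h2

/-- A convex subset of `ℝⁿ` that is dense is the whole space. -/
theorem _root_.Convex.eq_univ_of_closure_eq_univ {V : Type*} [NormedAddCommGroup V]
    [NormedSpace ℝ V] [FiniteDimensional ℝ V] {S : Set V} (hS : Convex ℝ S)
    (h : closure S = Set.univ) : S = Set.univ := by
  have hint : (interior S).Nonempty := by
    rw [hS.interior_nonempty_iff_affineSpan_eq_top]
    have hcl : IsClosed ((affineSpan ℝ S : AffineSubspace ℝ V) : Set V) :=
      AffineSubspace.closed_of_finiteDimensional _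
    have : closure S ⊆ (affineSpan ℝ S : Set V) :=
      closure_minimal (subset_affineSpan ℝ S) hcl
    rw [h, Set.univ_subset_iff] at this
    exact AffineSubspace.coe_eq_univ_iff _ |>.1 this
  have := hS.interior_closure_eq_interior_of_nonempty_interior hint
  rw [h, interior_univ] at this
  exact Set.univ_subset_iff.1 (this ▸ interior_subset)

/-- A linear functional bounded above on a set closed under positive scaling is nonpositive
there. -/
theorem inner_nonpos_of_forall_lt {n : ℕ} {S : Set (E n)} {d : E n} {u : ℝ}
    (hcone : ∀ x ∈ S, ∀ c : ℝ, 0 < c → c • x ∈ S) (h : ∀ x ∈ S, inner ℝ d x < u) :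
    ∀ x ∈ S, inner ℝ d x ≤ 0 := by
  intro x hx
  by_contra! hpos
  have h1 := h _ (hcone x hx ((|u| + 1) / inner ℝ d x) (by positivity))
  rw [inner_smul_right, div_mul_cancel₀ _ hpos.ne'] at h1
  linarith [le_abs_self u]

/-- The cone need not be closed: a proper convex set in finite dimension is not dense, so a point
can be separated from its closure. -/
theorem exists_ne_zero_inner_nonpos {n : ℕ} {S : Set (E n)} (hS : Convex ℝ S)
    (hcone : ∀ x ∈ S, ∀ c : ℝ, 0 < c → c • x ∈ S) (hne : S.Nonempty) (huniv : S ≠ Set.univ) :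
    ∃ d : E n, d ≠ 0 ∧ ∀ x ∈ S, inner ℝ d x ≤ 0 := by
  have hcl : closure S ≠ Set.univ := fun h => huniv (hS.eq_univ_of_closure_eq_univ h)
  obtain ⟨z, hz⟩ := (Set.ne_univ_iff_exists_notMem _).1 hcl
  obtain ⟨φ, u, h1, h2⟩ := geometric_hahn_banach_closed_point hS.closure isClosed_closure hz
  set d := (InnerProductSpace.toDual ℝ (E n)).symm φ with hd
  have hφ : ∀ x, inner ℝ d x = φ x := fun x => by simp [hd]
  refine ⟨d, ?_, inner_nonpos_of_forall_lt hcone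
    fun x hx => (hφ x).trans_lt (h1 x (subset_closure hx))⟩
  rintro h0
  obtain ⟨x, hx⟩ := hne
  have h3 := h1 x (subset_closure hx)
  rw [← hφ, h0, inner_zero_left] at h3 h2
  linarith

/-- The bipolar theorem for an ordering cone. -/
theorem mem_of_forall_polarCone {p : ℕ} {K : Set (E p)} (hK : IsOrderingCone K) {v : E p}
    (hv : ∀ y ∈ polarCone K, inner ℝ y v ≤ 0) : v ∈ K := by
  by_contra hvK
  obtain ⟨φ, u, h1, h2⟩ := geometric_hahn_banach_closed_point hK.convex hK.closed hvK
  set d := (InnerProductSpace.toDual ℝ (E p)).symm φ with hd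
  have hφ : ∀ x, inner ℝ d x = φ x := fun x => by simp [hd]
  have h3 := hv d (inner_nonpos_of_forall_lt (fun x hx c hc => hK.smul_mem x hx c hc.le)
    fun x hx => (hφ x).trans_lt (h1 x hx))
  have h0 : (0 : E p) ∈ K := by
    have : (0 : E p) ∈ K ∩ -K := by rw [hK.pointed]; rfl
    exact this.1
  have h4 := h1 0 h0
  rw [map_zero] at h4
  rw [← hφ] at h2
  linarith

theorem IsOrderingCone.add_mem {p : ℕ} {K : Set (E p)} (hK : IsOrderingCone K) {x y : E p}
    (hx : x ∈ K) (hy : y ∈ K) : x + y ∈ K := by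
  have h := hK.smul_mem _ (hK.convex hx hy (a := 1 / 2) (b := 1 / 2) (by norm_num) (by norm_num)
    (by norm_num)) 2 (by norm_num)
  convert h using 1
  module

theorem IsOrderingCone.eq_zero_of_mem_of_neg_mem {p : ℕ} {K : Set (E p)} (hK : IsOrderingCone K)
    {x : E p} (hx : x ∈ K) (hx' : -x ∈ K) : x = 0 := by
  have : x ∈ K ∩ -K := ⟨hx, hx'⟩
  rwa [hK.pointed] at this

/-- Otherwise a small positive multiple of `-k` lies in `K` for each `k ∈ K`, and pointedness
collapses `K` to `{0}`. -/
theorem IsOrderingCone.zero_notMem_interior {p : ℕ} {K : Set (E p)} (hK : IsOrderingCone K) :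
    (0 : E p) ∉ interior K := by
  intro h0
  refine hK.nontrivial (Set.Subset.antisymm (fun k hk => ?_) (fun k hk => ?_))
  · have hlim : Filter.Tendsto (fun s : ℝ => s • -k) (nhdsWithin 0 (Set.Ioi 0)) (nhds 0) := by
      have : Filter.Tendsto (fun s : ℝ => s • -k) (nhds 0) (nhds ((0 : ℝ) • -k)) :=
        Filter.tendsto_id.smul_const _
      rw [zero_smul] at this
      exact this.mono_left nhdsWithin_le_nhds
    obtain ⟨s, hs, hs0⟩ := ((hlim.eventually (mem_interior_iff_mem_nhds.1 h0)).and
      self_mem_nhdsWithin).exists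
    have hs0 : 0 < s := hs0
    have := hK.smul_mem _ hs s⁻¹ (inv_nonneg.2 hs0.le)
    rw [smul_smul, inv_mul_cancel₀ hs0.ne', one_smul] at this
    exact hK.eq_zero_of_mem_of_neg_mem hk this
  · rw [Set.mem_singleton_iff.1 hk]
    exact interior_subset h0

/-- A cube rather than a ball, because the errors in `f` are estimated coordinate by coordinate. -/
theorem exists_cube_subset {p : ℕ} {U : Set (E p)} (hU : IsOpen U) {e : E p} (he : e ∈ U) :
    ∃ η : ℝ, 0 < η ∧ ∀ w : E p, (∀ i, |w i| ≤ η) → e + w ∈ U := by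
  have hopen : IsOpen ((fun w : Fin p → ℝ => e + WithLp.toLp 2 w) ⁻¹' U) :=
    hU.preimage (by fun_prop)
  obtain ⟨η, hη, hsub⟩ := Metric.isOpen_iff.1 hopen 0 (by simpa using he)
  refine ⟨η / 2, by linarith, fun w hw => ?_⟩
  have : w.ofLp ∈ Metric.ball (0 : Fin p → ℝ) η := by
    rw [mem_ball_zero_iff]
    exact lt_of_le_of_lt ((pi_norm_le_iff_of_nonneg (by linarith)).2 hw) (by linarith)
  exact hsub this

/-! ### Descent and feasible directions for convex constraints -/

/-- If every subgradient is negative in the direction `d`, then `h` decreases along `d`. -/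
theorem exists_lt_of_forall_subdifferential_inner_neg {n : ℕ} {h : E n → ℝ}
    (hh : ConvexOn ℝ Set.univ h) (x₀ d : E n)
    (hd : ∀ ζ ∈ subdifferential h x₀, inner ℝ ζ d < 0) :
    ∃ t : ℝ, 0 < t ∧ h (x₀ + t • d) < h x₀ := by
  -- If `h` never drops below `h x₀` along the ray, the strict epigraph misses the horizontal ray
  -- `T` at height `h x₀`. A separating hyperplane is non-vertical (`b < 0`), and its normalized
  -- slope is a subgradient with nonnegative value on `d`.
  by_contra! H
  have hcont : Continuous h := hh.locallyLipschitz.continuous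
  let s : Set (E n × ℝ) := {q | h q.1 < q.2}
  let T : Set (E n × ℝ) := {q | ∃ t : ℝ, 0 ≤ t ∧ q = (x₀ + t • d, h x₀)}
  have hs : Convex ℝ s := by simpa [s] using hh.convex_strict_epigraph
  have hso : IsOpen s := isOpen_lt (hcont.comp continuous_fst) continuous_snd
  have hT : Convex ℝ T := by
    rintro _ ⟨t, ht, rfl⟩ _ ⟨t', ht', rfl⟩ a b ha hb hab
    refine ⟨a * t + b * t', by positivity, ?_⟩
    obtain rfl : b = 1 - a := by linarith
    ext1
    · simp only [Prod.smul_mk, Prod.mk_add_mk]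
      module
    · simp only [Prod.smul_mk, Prod.mk_add_mk, smul_eq_mul]
      ring
  have hdisj : Disjoint s T := by
    rw [Set.disjoint_left]
    rintro _ hq ⟨t, ht, rfl⟩
    have hq : h (x₀ + t • d) < h x₀ := hq
    rcases ht.eq_or_lt with rfl | ht
    · simp at hq
    · exact absurd hq (not_lt.2 (H t ht))
  obtain ⟨φ, u, h1, h2⟩ := geometric_hahn_banach_open hs hso hT hdisj
  let a : StrongDual ℝ (E n) := φ.comp (ContinuousLinearMap.inl ℝ (E n) ℝ)
  let b : ℝ := φ (0, 1)
  have hφ : ∀ x y, φ (x, y) = a x + y * b := by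
    intro x y
    have : ((x, y) : E n × ℝ) = (x, 0) + y • (0, 1) := by simp
    rw [this, map_add, map_smul]
    rfl
  have key : ∀ x y t, h x < y → 0 ≤ t → a x + y * b < a x₀ + t * a d + h x₀ * b := by
    intro x y t hxy ht
    have := (h1 (x, y) hxy).trans_le (h2 _ ⟨t, ht, rfl⟩)
    rw [hφ, hφ, map_add, map_smul, smul_eq_mul] at this
    exact this
  have hb : b < 0 := by
    have := key x₀ (h x₀ + 1) 0 (by linarith) le_rfl
    linarith
  have had : 0 ≤ a d := by
    by_contra! hneg
    -- This `t` makes `t * a d = b`, so both sides of `key` coincide.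
    have := key x₀ (h x₀ + 1) (b / a d) (by linarith) (div_nonneg_of_nonpos hb.le hneg.le)
    rw [div_mul_cancel₀ _ hneg.ne] at this
    linarith
  have hsub : ∀ x, a x + h x * b ≤ a x₀ + h x₀ * b := by
    intro x
    refine le_of_forall_pos_lt_add fun ε hε => ?_
    have := key x (h x + ε / (-b)) 0 (by have := div_pos hε (neg_pos.2 hb); linarith) le_rfl
    have h5 : ε / (-b) * b = -ε := by field_simp [hb.ne]
    linarith
  have hz : ∀ x, inner ℝ ((-b)⁻¹ • (InnerProductSpace.toDual ℝ (E n)).symm a) x = (-b)⁻¹ * a x := by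
    intro x
    simp [inner_smul_left]
  have hnb : 0 < (-b)⁻¹ := inv_pos.2 (neg_pos.2 hb)
  have := hd ((-b)⁻¹ • (InnerProductSpace.toDual ℝ (E n)).symm a) (by
    intro x
    rw [hz, map_sub, ge_iff_le, inv_mul_le_iff₀ (neg_pos.2 hb)]
    linarith [hsub x])
  rw [hz] at this
  nlinarith

/-- Under compactness and joint continuity of the constraints, a direction in which every active
subgradient is negative is feasible. -/
theorem eventually_mem_feasibleSet {n : ℕ} {J : Type*} [TopologicalSpace J] [CompactSpace J]
    {g : J → E n → ℝ} (hg : ∀ j, ConvexOn ℝ Set.univ (g j))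
    (hcont : Continuous (fun q : J × E n => g q.1 q.2)) {x₀ : E n} (hx₀ : x₀ ∈ feasibleSet g)
    {d : E n} (hd : ∀ j ∈ activeSet g x₀, ∀ ζ ∈ subdifferential (g j) x₀, inner ℝ ζ d < 0) :
    ∀ᶠ t in nhdsWithin (0 : ℝ) (Set.Ioi 0), x₀ + t • d ∈ feasibleSet g := by
  have hloc : ∀ j, ∃ t : ℝ, 0 < t ∧ g j (x₀ + t • d) < 0 := by
    intro j
    rcases (hx₀ j).lt_or_eq with hlt | heq
    · have hlim : Filter.Tendsto (fun t : ℝ => g j (x₀ + t • d)) (nhdsWithin 0 (Set.Ioi 0))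
          (nhds (g j x₀)) := by
        have h1 : Continuous (fun t : ℝ => g j (x₀ + t • d)) :=
          hcont.comp (continuous_const.prodMk (by fun_prop))
        have := h1.tendsto 0
        rw [zero_smul, add_zero] at this
        exact this.mono_left nhdsWithin_le_nhds
      obtain ⟨t, ht, ht0⟩ := ((hlim.eventually_lt_const hlt).and self_mem_nhdsWithin).exists
      exact ⟨t, ht0, ht⟩
    · obtain ⟨t, ht, h⟩ := exists_lt_of_forall_subdifferential_inner_neg (hg j) x₀ d (hd j heq)
      exact ⟨t, ht, by rwa [heq] at h⟩
  -- One good step length `s` makes all shorter ones feasible. Negativity at `s` is open in the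
  -- index, so compactness of `J` gives a common bound.
  have hconv : ∀ j (s : ℝ), 0 < s → g j (x₀ + s • d) < 0 →
      ∀ t : ℝ, 0 < t → t < s → g j (x₀ + t • d) ≤ 0 := by
    intro j s hs hgs t ht hts
    have := (hg j).2 (Set.mem_univ x₀) (Set.mem_univ (x₀ + s • d))
      (sub_nonneg.2 ((div_le_one hs).2 hts.le)) (div_nonneg ht.le hs.le) (by ring)
    rw [show (1 - t / s) • x₀ + (t / s) • (x₀ + s • d) = x₀ + (t / s * s) • d by module,
      div_mul_cancel₀ _ hs.ne'] at this
    refine this.trans (add_nonpos ?_ ?_)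
    · exact mul_nonpos_of_nonneg_of_nonpos (sub_nonneg.2 ((div_le_one hs).2 hts.le)) (hx₀ j)
    · exact mul_nonpos_of_nonneg_of_nonpos (div_nonneg ht.le hs.le) hgs.le
  have hcpt : ∀ᶠ t in nhdsWithin (0 : ℝ) (Set.Ioi 0),
      ∀ j ∈ (Set.univ : Set J), g j (x₀ + t • d) ≤ 0 := by
    refine isCompact_univ.induction_on
      (p := fun A => ∀ᶠ t in nhdsWithin (0 : ℝ) (Set.Ioi 0), ∀ j ∈ A, g j (x₀ + t • d) ≤ 0)
      (by simp) (fun A B hAB hB => hB.mono fun t ht j hj => ht j (hAB hj))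
      (fun A B hA hB => ?_) (fun j _ => ?_)
    · filter_upwards [hA, hB] with t h1 h2 j hj
      exact hj.elim (h1 j) (h2 j)
    · obtain ⟨s, hs, hgs⟩ := hloc j
      have h1 : Continuous (fun i : J => g i (x₀ + s • d)) :=
        hcont.comp (continuous_id.prodMk continuous_const)
      refine ⟨{i | g i (x₀ + s • d) < 0}, mem_nhdsWithin_of_mem_nhds
        ((isOpen_lt h1 continuous_const).mem_nhds hgs), ?_⟩
      filter_upwards [self_mem_nhdsWithin, Ioo_mem_nhdsGT hs] with t ht0 ht i hi
      exact hconv i s hs hi t ht0 ht.2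
  exact hcpt.mono fun t ht j => ht j (Set.mem_univ j)

/-! ### Necessity: a polar direction destroys robustness -/

/-- The box of directional values lies in `-K` when `d` is polar to `-∂f(x₀) K*`. -/
theorem neg_mem_of_forall_clarkeDeriv {n p : ℕ} {K : Set (E p)} (hK : IsOrderingCone K)
    {f : E n → E p} (hf : ∀ i, LocallyLipschitz (fun x => f x i)) {x₀ d : E n}
    (hd : ∀ z ∈ matSetMul (-(clarkeGradientVec f x₀)) (polarCone K), inner ℝ d z ≤ 0)
    {v : E p} (hv₁ : ∀ i, -clarkeDeriv (fun x => f x i) x₀ (-d) ≤ v i)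
    (hv₂ : ∀ i, v i ≤ clarkeDeriv (fun x => f x i) x₀ d) : -v ∈ K := by
  refine mem_of_forall_polarCone hK fun y hy => ?_
  -- One gradient per component, assembled as the columns of a single matrix.
  choose ζ hζ hζv using fun i => exists_mem_clarkeGradient_inner_eq (hf i) (hv₁ i) (hv₂ i)
  let ξ : Matrix (Fin n) (Fin p) ℝ := Matrix.of fun k i => ζ i k
  have hξ : ξ ∈ clarkeGradientVec f x₀ := fun i => hζ i
  have h1 := hd (matVec (-ξ) y) (Set.mem_image2_of_mem (by simpa using hξ) hy)
  rw [inner_matVec_neg] at h1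
  have h2 : ∀ i, inner ℝ (WithLp.toLp 2 (fun k => ξ k i) : E n) d = v i := fun i => hζv i
  simp only [h2] at h1
  rw [inner_neg_right, PiLp.inner_apply]
  simpa [mul_comm] using h1

/-- Along `d`, the difference quotients of a locally Lipschitz function are eventually within `η` of
the interval `[-h°(x₀; -d), h°(x₀; d)]`. -/
theorem eventually_clarke_quotient_bounds {n : ℕ} {h : E n → ℝ} (hh : LocallyLipschitz h)
    (x₀ d : E n) {η : ℝ} (hη : 0 < η) :
    ∀ᶠ t in nhdsWithin (0 : ℝ) (Set.Ioi 0),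
      -clarkeDeriv h x₀ (-d) - η < (h (x₀ + t • d) - h x₀) / t ∧
      (h (x₀ + t • d) - h x₀) / t < clarkeDeriv h x₀ d + η := by
  have h0 : Filter.Tendsto (fun t : ℝ => t) (nhdsWithin 0 (Set.Ioi 0)) (nhds 0) :=
    Filter.tendsto_id.mono_left nhdsWithin_le_nhds
  have h1 := (tendsto_clarkeFilter (tendsto_const_nhds (x := x₀)) h0
    self_mem_nhdsWithin).eventually (eventually_clarkeQuotient_lt hh (d := d)
      (lt_add_of_pos_right (clarkeDeriv h x₀ d) hη))
  have hu : Filter.Tendsto (fun t : ℝ => x₀ + t • d) (nhdsWithin 0 (Set.Ioi 0)) (nhds x₀) := by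
    simpa using (h0.smul_const d).const_add x₀
  -- The lower bound comes from stepping back by `-d` from the moving base point `x₀ + t d`.
  have h2 := (tendsto_clarkeFilter hu h0 self_mem_nhdsWithin).eventually
    (eventually_clarkeQuotient_lt hh (d := -d)
      (lt_add_of_pos_right (clarkeDeriv h x₀ (-d)) hη))
  filter_upwards [h1, h2] with t ht1 ht2
  refine ⟨?_, ht1⟩
  simp only [clarkeQuotient, smul_neg, add_neg_cancel_right] at ht2
  rw [show (h (x₀ + t • d) - h x₀) / t = -((h x₀ - h (x₀ + t • d)) / t) by ring]
  linarith

theorem exists_near_of_mem_Icc {a b η x : ℝ} (hab : a ≤ b) (h₁ : a - η ≤ x) (h₂ : x ≤ b + η)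
    (hη : 0 ≤ η) : ∃ v, a ≤ v ∧ v ≤ b ∧ |x - v| ≤ η := by
  rcases le_total x a with h | h
  · exact ⟨a, le_rfl, hab, abs_le.2 ⟨by linarith, by linarith⟩⟩
  rcases le_total x b with h' | h'
  · exact ⟨x, h, h', by simpa using hη⟩
  · exact ⟨b, hab, le_rfl, abs_le.2 ⟨by linarith, by linarith⟩⟩

theorem exists_pos_forall_mul_le {ι : Type*} [Finite ι] (M : ι → ℝ) {a : ℝ} (ha : 0 < a) :
    ∃ δ : ℝ, 0 < δ ∧ ∀ i, δ * M i ≤ a := by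
  have : ∀ i, ∀ᶠ δ in nhdsWithin (0 : ℝ) (Set.Ioi 0), δ * M i < a := by
    intro i
    have h1 : Filter.Tendsto (fun δ : ℝ => δ * M i) (nhds 0) (nhds (0 * M i)) :=
      Filter.tendsto_id.mul_const _
    rw [zero_mul] at h1
    exact (h1.mono_left nhdsWithin_le_nhds).eventually_lt_const ha
  obtain ⟨δ, hδ, hδ0⟩ := ((Filter.eventually_all.2 this).and self_mem_nhdsWithin).exists
  exact ⟨δ, hδ0, fun i => (hδ i).le⟩

/-- Along `d` the values of `f` are only weakly improving to first order and feasibility is only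
marginal. The Slater point repairs feasibility, and a rank-one perturbation provides the room inside
`K`. -/
theorem not_isNormRobust_of_direction {n p : ℕ} {J : Type*} [TopologicalSpace J]
    {K : Set (E p)} (hK : IsOrderingCone K) (hKint : (interior K).Nonempty)
    {f : E n → E p} (hf : ∀ i, LocallyLipschitz (fun x => f x i))
    {g : J → E n → ℝ} (hg : ∀ j, ConvexOn ℝ Set.univ (g j))
    {x₀ : E n} (hx₀ : x₀ ∈ feasibleSet g) (hscq : SCQ g) {d : E n} (hd0 : d ≠ 0)
    (hdf : ∀ z ∈ matSetMul (-(clarkeGradientVec f x₀)) (polarCone K), inner ℝ d z ≤ 0)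
    (hdg : ∀ j ∈ activeSet g x₀, ∀ ζ ∈ subdifferential (g j) x₀, inner ℝ d ζ ≤ 0) :
    ¬ IsNormRobust K f (feasibleSet g) x₀ := by
  rintro ⟨r, hr, hrob⟩
  obtain ⟨hcomp, hcont, s, hs⟩ := hscq
  obtain ⟨e, he⟩ := hKint
  obtain ⟨η, hη, hcube⟩ := exists_cube_subset isOpen_interior he
  obtain ⟨ε, hε, hball⟩ := exists_smul_mem_frobeniusBall
    (Matrix.of fun (i : Fin p) (k : Fin n) => -(e i * d k) / inner ℝ d d) hr
  -- `C = -ε e dᵀ / ‖d‖²`, so `C d = -ε e`; `ε` only serves to fit `C` into the ball.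
  set C := ε • (Matrix.of fun (i : Fin p) (k : Fin n) => -(e i * d k) / inner ℝ d d) with hC
  have hdd : (0 : ℝ) < inner ℝ d d := real_inner_self_pos.2 hd0
  have hCx : ∀ x : E n, ∀ i, matVec C x i = -ε * e i * (inner ℝ d x / inner ℝ d d) := by
    intro x i
    simp only [hC, matVec, Matrix.mulVec, dotProduct, Matrix.smul_apply, Matrix.of_apply]
    rw [PiLp.inner_apply (𝕜 := ℝ) d x, Finset.sum_div, Finset.mul_sum]
    refine Finset.sum_congr rfl fun k _ => ?_
    simp only [RCLike.inner_apply, conj_trivial, smul_eq_mul]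
    ring
  set d₀ := s - x₀ with hd₀
  set κ : ℝ := inner ℝ d d₀ / inner ℝ d d with hκ
  have hd₀neg : ∀ j ∈ activeSet g x₀, ∀ ζ ∈ subdifferential (g j) x₀, inner ℝ ζ d₀ < 0 := by
    intro j hj ζ hζ
    have h1 := hζ s
    have h2 : g j x₀ = 0 := hj
    linarith [hs j]
  -- the size of the perturbation of the direction
  obtain ⟨δ, hδ, hδM⟩ := exists_pos_forall_mul_le
    (fun i : Fin p => |clarkeDeriv (fun x => f x i) x₀ d₀| +
      |clarkeDeriv (fun x => f x i) x₀ (-d₀)| + ε * |κ * e i|)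
    (show 0 < ε * η / 2 by positivity)
  -- The tilt costs at most `ε η / 2` per coordinate, counting its effect on both `f` and `C`. The
  -- difference quotients use the other `ε η / 2`.
  set d' := d + δ • d₀ with hd'
  have hfeas : ∀ᶠ t in nhdsWithin (0 : ℝ) (Set.Ioi 0), x₀ + t • d' ∈ feasibleSet g := by
    refine eventually_mem_feasibleSet hg hcont hx₀ fun j hj ζ hζ => ?_
    have h1 := hdg j hj ζ hζ
    rw [real_inner_comm] at h1
    have h2 := mul_neg_of_pos_of_neg hδ (hd₀neg j hj ζ hζ)
    rw [hd', inner_add_right, inner_smul_right]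
    linarith
  have hquot : ∀ᶠ t in nhdsWithin (0 : ℝ) (Set.Ioi 0), ∀ i : Fin p, _ :=
    Filter.eventually_all.2 fun i => eventually_clarke_quotient_bounds (hf i) x₀ d'
      (show 0 < ε * η / 2 by positivity)
  obtain ⟨t, ⟨htfeas, htq⟩, ht⟩ := ((hfeas.and hquot).and self_mem_nhdsWithin).exists
  have ht : 0 < t := ht
  let q : E p := t⁻¹ • (f (x₀ + t • d') - f x₀)
  have hq : ∀ i, q i = (f (x₀ + t • d') i - f x₀ i) / t := by
    intro i
    simp [q, div_eq_inv_mul]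
  have hnear : ∀ i, ∃ v, -clarkeDeriv (fun x => f x i) x₀ (-d) ≤ v ∧
      v ≤ clarkeDeriv (fun x => f x i) x₀ d ∧ |q i - v| ≤ δ *
        (|clarkeDeriv (fun x => f x i) x₀ d₀| + |clarkeDeriv (fun x => f x i) x₀ (-d₀)|) +
        ε * η / 2 := by
    intro i
    have hq1 := (htq i).1
    have hq2 := (htq i).2
    rw [← hq] at hq1 hq2
    have hup : clarkeDeriv (fun x => f x i) x₀ d' ≤ clarkeDeriv (fun x => f x i) x₀ d +
        δ * clarkeDeriv (fun x => f x i) x₀ d₀ := by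
      rw [← clarkeDeriv_smul (hf i) x₀ d₀ hδ]
      exact clarkeDeriv_add_le (hf i) x₀ d (δ • d₀)
    have hlo : clarkeDeriv (fun x => f x i) x₀ (-d') ≤ clarkeDeriv (fun x => f x i) x₀ (-d) +
        δ * clarkeDeriv (fun x => f x i) x₀ (-d₀) := by
      rw [← clarkeDeriv_smul (hf i) x₀ (-d₀) hδ, hd', neg_add, ← smul_neg]
      exact clarkeDeriv_add_le (hf i) x₀ (-d) (δ • -d₀)
    have a1 := mul_le_mul_of_nonneg_left (le_abs_self (clarkeDeriv (fun x => f x i) x₀ d₀)) hδ.le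
    have a2 := mul_le_mul_of_nonneg_left
      (le_abs_self (clarkeDeriv (fun x => f x i) x₀ (-d₀))) hδ.le
    have a3 := mul_nonneg hδ.le (abs_nonneg (clarkeDeriv (fun x => f x i) x₀ d₀))
    have a4 := mul_nonneg hδ.le (abs_nonneg (clarkeDeriv (fun x => f x i) x₀ (-d₀)))
    rw [mul_add]
    exact exists_near_of_mem_Icc (neg_clarkeDeriv_neg_le (hf i) x₀ d) (by linarith) (by linarith)
      (by positivity)
  choose v hv1 hv2 hv3 using hnear
  have hvK := neg_mem_of_forall_clarkeDeriv hK hf hdf (v := WithLp.toLp 2 v) hv1 hv2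
  -- the perturbed value lies in `-int K`
  let w : E p := WithLp.toLp 2 fun i => ε⁻¹ * (-(q i - v i) + ε * δ * κ * e i)
  have hw : e + w ∈ interior K := by
    refine hcube w fun i => ?_
    change |ε⁻¹ * (-(q i - v i) + ε * δ * κ * e i)| ≤ η
    rw [abs_mul, abs_of_pos (inv_pos.2 hε), inv_mul_le_iff₀ hε]
    refine (abs_add_le _ _).trans ?_
    rw [abs_neg, show ε * δ * κ * e i = δ * ε * (κ * e i) by ring, abs_mul,
      abs_of_pos (mul_pos hδ hε)]
    have := hδM i
    have := hv3 i
    nlinarith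
  have hval : q + matVec C d' = WithLp.toLp 2 v - ε • (e + w) := by
    ext i
    simp only [PiLp.add_apply, PiLp.sub_apply, PiLp.smul_apply, smul_eq_mul, hCx, w, hd',
      inner_add_right, inner_smul_right]
    have h1 : (inner ℝ d d + δ * inner ℝ d d₀) / inner ℝ d d = 1 + δ * κ := by
      rw [hκ]; field_simp
    rw [h1]
    field_simp
    ring
  have hmemK : -(q + matVec C d') ∈ K := by
    rw [hval, neg_sub, sub_eq_add_neg]
    exact hK.add_mem (hK.smul_mem _ (interior_subset hw) ε hε.le) hvK
  -- Otherwise `e + w` and its negative both lie in `K`, so 0 would be interior to `K`.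
  have hne : q + matVec C d' ≠ 0 := by
    intro h0
    rw [hval, sub_eq_zero] at h0
    have h1 : e + w = 0 := by
      refine hK.eq_zero_of_mem_of_neg_mem (interior_subset hw) ?_
      have := hK.smul_mem _ hvK ε⁻¹ (inv_nonneg.2 hε.le)
      rwa [h0, smul_neg, smul_smul, inv_mul_cancel₀ hε.ne', one_smul] at this
    exact hK.zero_notMem_interior (h1 ▸ hw)
  refine (hrob C hball).2 ⟨x₀ + t • d', htfeas, ?_⟩
  have hfin : f (x₀ + t • d') + matVec C (x₀ + t • d') - (f x₀ + matVec C x₀) =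
      t • (q + matVec C d') := by
    rw [smul_add t q, show t • q = f (x₀ + t • d') - f x₀ by simp [q, smul_smul, ht.ne'],
      matVec_add, matVec_smul]
    abel
  change f (x₀ + t • d') + matVec C (x₀ + t • d') - (f x₀ + matVec C x₀) ∈ _
  rw [hfin]
  refine ⟨?_, ?_⟩
  · rw [Set.mem_neg, ← smul_neg]
    exact hK.smul_mem _ hmemK t ht.le
  · rw [Set.mem_singleton_iff, smul_eq_zero, not_or]
    exact ⟨ht.ne', hne⟩

theorem clarkeGradientVec_nonempty {n p : ℕ} {f : E n → E p}
    (hf : ∀ i, LocallyLipschitz (fun x => f x i)) (x₀ : E n) :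
    (clarkeGradientVec f x₀).Nonempty := by
  choose ζ hζ _ using fun i => exists_mem_clarkeGradient_inner_eq (hf i) (x₀ := x₀)
    (neg_clarkeDeriv_neg_le (hf i) x₀ 0) le_rfl
  exact ⟨Matrix.of fun k i => ζ i k, fun i => hζ i⟩

theorem smul_mem_polarCone {p : ℕ} {K : Set (E p)} {y : E p} (hy : y ∈ polarCone K) {c : ℝ}
    (hc : 0 ≤ c) : c • y ∈ polarCone K := by
  intro x hx
  rw [inner_smul_left]
  exact mul_nonpos_of_nonneg_of_nonpos hc (hy x hx)

/-- The scalar is absorbed by the polar cone factor, so the hull is a cone although the set of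
matrices is not. -/
theorem smul_mem_convexHull_matSetMul {m p : ℕ} {K : Set (E p)}
    {W : Set (Matrix (Fin m) (Fin p) ℝ)} {z : E m}
    (hz : z ∈ convexHull ℝ (matSetMul W (polarCone K))) {c : ℝ} (hc : 0 ≤ c) :
    c • z ∈ convexHull ℝ (matSetMul W (polarCone K)) := by
  have h1 : c • z ∈ c • convexHull ℝ (matSetMul W (polarCone K)) := Set.smul_mem_smul_set hz
  rw [← convexHull_smul] at h1
  refine convexHull_mono ?_ h1
  rintro _ ⟨_, ⟨ξ, hξ, y, hy, rfl⟩, rfl⟩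
  exact ⟨ξ, hξ, c • y, smul_mem_polarCone hy hc, matVec_smul ξ c y⟩

theorem convexHull_add_pos_eq_univ {n p : ℕ} {J : Type*} [TopologicalSpace J]
    {K : Set (E p)} (hK : IsOrderingCone K) (hKint : (interior K).Nonempty)
    {f : E n → E p} (hf : ∀ i, LocallyLipschitz (fun x => f x i))
    {g : J → E n → ℝ} (hg : ∀ j, ConvexOn ℝ Set.univ (g j))
    {x₀ : E n} (hx₀ : x₀ ∈ feasibleSet g) (hscq : SCQ g)
    (hrob : IsNormRobust K f (feasibleSet g) x₀) :
    convexHull ℝ (matSetMul (-(clarkeGradientVec f x₀)) (polarCone K)) +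
      pos (⋃ j ∈ activeSet g x₀, subdifferential (g j) x₀) = Set.univ := by
  by_contra huniv
  -- With 0 in both summands, the polar vector can be tested on each separately.
  have h0 : (0 : E n) ∈ convexHull ℝ (matSetMul (-(clarkeGradientVec f x₀)) (polarCone K)) := by
    obtain ⟨ξ, hξ⟩ := clarkeGradientVec_nonempty hf x₀
    refine subset_convexHull ℝ _ ⟨-ξ, by simpa using hξ, 0, fun x _ => by simp, ?_⟩
    simp [matVec]
  obtain ⟨d, hd0, hd⟩ := exists_ne_zero_inner_nonpos
    ((convex_convexHull ℝ _).add (convex_pos _)) (by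
      rintro _ ⟨a, ha, b, hb, rfl⟩ c hc
      exact ⟨c • a, smul_mem_convexHull_matSetMul ha hc.le, c • b, smul_mem_pos hb hc.le,
        (smul_add c a b).symm⟩)
    ⟨0, Set.mem_add.2 ⟨0, h0, 0, zero_mem_pos _, add_zero 0⟩⟩ huniv
  refine not_isNormRobust_of_direction hK hKint hf hg hx₀ hscq hd0 (fun z hz => ?_)
    (fun j hj ζ hζ => ?_) hrob
  · exact hd z (Set.mem_add.2 ⟨z, subset_convexHull ℝ _ hz, 0, zero_mem_pos _, add_zero z⟩)
  · exact hd ζ (Set.mem_add.2 ⟨0, h0, ζ, subset_pos _ (Set.mem_biUnion hj hζ), zero_add ζ⟩)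

/-! ### Sufficiency under `K`-convexity -/

theorem KConvex.convexOn_inner {n p : ℕ} {K : Set (E p)} {f : E n → E p} (hf : KConvex K f)
    {μ : E p} (hμ : μ ∈ -(polarCone K)) : ConvexOn ℝ Set.univ (fun x => inner ℝ μ (f x)) := by
  refine ⟨convex_univ, fun x _ y _ a b ha hb hab => ?_⟩
  obtain rfl : b = 1 - a := by linarith
  have h1 := hμ _ (hf x y a ha (by linarith))
  simp only [inner_neg_left, inner_neg_right, inner_sub_right, inner_smul_right] at h1
  simp only [smul_eq_mul]
  linarith

/-- For a subgradient of `μ ∘ f`, domination gives `⟨μ, f x - f x₀⟩ ≤ -⟨μ, C (x - x₀)⟩`, so `M =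
‖μ‖` works. For an active constraint, feasibility of `x` gives `M = 0`. -/
theorem isNormRobust_of_pos_add_pos_eq_univ {n p : ℕ} {J : Type*}
    {K : Set (E p)} {f : E n → E p} {g : J → E n → ℝ} {x₀ : E n} (hx₀ : x₀ ∈ feasibleSet g)
    (hconv : KConvex K f)
    (h : pos (⋃ μ ∈ -(polarCone K), clarkeGradient (fun x => inner ℝ μ (f x)) x₀) +
        pos (⋃ j ∈ activeSet g x₀, subdifferential (g j) x₀) = Set.univ) :
    IsNormRobust K f (feasibleSet g) x₀ := by
  -- the vectors `z` that are controlled by the perturbation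
  let Q : Submodule NNReal (E n) :=
    { carrier := {z | ∃ M : ℝ, 0 ≤ M ∧ ∀ r : ℝ, 0 ≤ r → ∀ C ∈ frobeniusBall p n r,
        ∀ x ∈ feasibleSet g, f x + matVec C x - (f x₀ + matVec C x₀) ∈ -K →
          inner ℝ z (x - x₀) ≤ M * r * ‖x - x₀‖}
      zero_mem' := ⟨0, le_rfl, by simp⟩
      add_mem' := by
        rintro a b ⟨M, hM, ha⟩ ⟨N, hN, hb⟩
        refine ⟨M + N, add_nonneg hM hN, fun r hr C hC x hx hxK => ?_⟩
        rw [inner_add_left]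
        linarith [ha r hr C hC x hx hxK, hb r hr C hC x hx hxK]
      smul_mem' := by
        rintro c a ⟨M, hM, ha⟩
        refine ⟨c * M, mul_nonneg c.2 hM, fun r hr C hC x hx hxK => ?_⟩
        have h1 := mul_le_mul_of_nonneg_left (ha r hr C hC x hx hxK) c.2
        have h2 : inner ℝ (c • a) (x - x₀) = (c : ℝ) * inner ℝ a (x - x₀) :=
          real_inner_smul_left a (x - x₀) c
        rw [h2]
        simpa [mul_assoc] using h1 }
  have hQ : ∀ z, z ∈ Q := by
    intro z
    obtain ⟨a, ha, b, hb, rfl⟩ : z ∈ pos _ + pos _ := h ▸ Set.mem_univ z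
    rw [pos_eq_span] at ha hb
    refine Q.add_mem (Submodule.span_le.2 ?_ ha) (Submodule.span_le.2 ?_ hb)
    · intro ζ hζ
      obtain ⟨μ, hμ, hζ⟩ := Set.mem_iUnion₂.1 hζ
      refine ⟨‖μ‖, norm_nonneg _, fun r hr C hC x hx hxK => ?_⟩
      have h1 := clarkeGradient_subset_subdifferential (hconv.convexOn_inner hμ) x₀ hζ x
      have h2 := hμ _ hxK
      have h3 : -(inner ℝ μ (matVec C (x - x₀))) ≤ ‖μ‖ * (r * ‖x - x₀‖) :=
        (neg_le_abs _).trans ((abs_real_inner_le_norm _ _).trans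
          (mul_le_mul_of_nonneg_left (norm_matVec_le hC _) (norm_nonneg _)))
      rw [matVec_sub] at h3
      simp only [inner_neg_left, inner_neg_right, inner_sub_right, inner_add_right]
        at h1 h2 h3 ⊢
      linarith
    · intro ζ hζ
      obtain ⟨j, hj, hζ⟩ := Set.mem_iUnion₂.1 hζ
      refine ⟨0, le_rfl, fun r hr C hC x hx hxK => ?_⟩
      have h1 := hζ x
      have h2 : g j x₀ = 0 := hj
      have h3 := hx j
      linarith
  choose M hM hMle using hQ
  let b := EuclideanSpace.basisFun (Fin n) ℝ
  let N : ℝ := ∑ i, (M (b i) + M (-b i))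
  have hN : 0 ≤ N := Finset.sum_nonneg fun i _ => add_nonneg (hM _) (hM _)
  -- This radius makes `N r < 1`, so the final estimate is a strict contraction.
  refine ⟨(N + 1)⁻¹, by positivity, fun C hC => ⟨hx₀, ?_⟩⟩
  rintro ⟨x, hx, hxK, hxne⟩
  have hr : (0 : ℝ) ≤ (N + 1)⁻¹ := by positivity
  have hle : ‖x - x₀‖ ≤ N * (N + 1)⁻¹ * ‖x - x₀‖ := by
    calc ‖x - x₀‖ = ‖∑ i, inner ℝ (b i) (x - x₀) • b i‖ := by rw [b.sum_repr']
      _ ≤ ∑ i, ‖inner ℝ (b i) (x - x₀) • b i‖ := norm_sum_le _ _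
      _ ≤ ∑ i, (M (b i) + M (-b i)) * ((N + 1)⁻¹ * ‖x - x₀‖) := by
        refine Finset.sum_le_sum fun i _ => ?_
        rw [norm_smul, b.orthonormal.1, mul_one, Real.norm_eq_abs]
        have h1 := hMle (b i) _ hr C hC x hx hxK
        have h2 := hMle (-b i) _ hr C hC x hx hxK
        rw [inner_neg_left] at h2
        have h3 := mul_nonneg (hM (b i)) (mul_nonneg hr (norm_nonneg (x - x₀)))
        have h4 := mul_nonneg (hM (-b i)) (mul_nonneg hr (norm_nonneg (x - x₀)))
        rw [mul_assoc] at h1 h2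
        exact abs_le.2 ⟨by linarith, by linarith⟩
      _ = N * (N + 1)⁻¹ * ‖x - x₀‖ := by rw [← Finset.sum_mul]; ring
  have hlt : N * (N + 1)⁻¹ < 1 := by
    rw [← div_eq_mul_inv, div_lt_one (by positivity)]
    linarith
  have hx0 : ‖x - x₀‖ = 0 := by
    by_contra hne
    have hpos : 0 < ‖x - x₀‖ := lt_of_le_of_ne (norm_nonneg _) (Ne.symm hne)
    nlinarith
  rw [norm_eq_zero, sub_eq_zero] at hx0
  exact hxne (by simp [hx0])

end RobustVOP

theorem mainTheorem5 {n p : ℕ} {J : Type*} [TopologicalSpace J]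
    (K : Set (E p)) (hK : IsOrderingCone K) (hKint : (interior K).Nonempty)
    (f : E n → E p) (hf : ∀ i, LocallyLipschitz (fun x => f x i))
    (g : J → E n → ℝ) (hg : ∀ j, ConvexOn ℝ Set.univ (g j))
    (x₀ : E n) (hx₀ : x₀ ∈ feasibleSet g) :
    ((0 : E n) ∉ convexHull ℝ (⋃ j ∈ activeSet g x₀, subdifferential (g j) x₀) →
      SCQ g →
      IsNormRobust K f (feasibleSet g) x₀ →
      convexHull ℝ (matSetMul (-(clarkeGradientVec f x₀)) (polarCone K)) +
        pos (⋃ j ∈ activeSet g x₀, subdifferential (g j) x₀) = Set.univ) ∧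
    (KConvex K f →
      pos (⋃ μ ∈ -(polarCone K), clarkeGradient (fun x => inner ℝ μ (f x)) x₀) +
        pos (⋃ j ∈ activeSet g x₀, subdifferential (g j) x₀) = Set.univ →
      IsNormRobust K f (feasibleSet g) x₀) :=
  ⟨fun _ hscq hrob => convexHull_add_pos_eq_univ hK hKint hf hg hx₀ hscq hrob,
    fun hconv h => isNormRobust_of_pos_add_pos_eq_univ hx₀ hconv h⟩
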